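/- Let $S=\{s_1,s_2,s_3,\dots\}$ be a countably infinite set with an arbitrary enumeration, and let $p\in[0,1]$. Let $m=(m(s,t))_{s,t\in S}$ be a random Coxeter matrix on a probability space, that is, a random matrix with entries in $\{1,2,3,\dots\}\cup\{\infty\}$ such that $m(s,t)=m(t,s)$, $m(s,s)=1$ and $m(s,t)\ge 2$ for $s\neq t$. Assume that the entries $m(s,t)$, indexed by the unordered pairs $\{s,t\}$ with $s\ne t$, are (jointly) independent and identically distributed, with $$\mathbb P(m(s,t)=2)=p,\qquad \mathbb P\bigl(m(s,t)\in\{3,4,\dots,\infty\}\bigr)=1-p .$$ Let $G_m$ be the Coxeter group generated by $S$ with the relations $(st)^{m(s,t)}=1$ for all $s,t\in S$ with $m(s,t)<\infty$, and let $\varphi:\mathbb C G_m\to\mathbb C$, $\varphi\bigl(\sum_x a_x\delta(x)\bigr)=a_1$, be the canonical trace on its group algebra, where $1$ is the identity of $G_m$. For a partition $V$ of $\{1,\dots,2r\}$ into pairs, let $I(V)$ be its set of inversions (crossings), i.e. the set of ordered pairs of blocks $(\{e,f\},\{e',f'\})$ of $V$ with $e<e'<f<f'$. **Theorem.** Almost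 surely, for all $k\in\mathbb N$, $$\lim_{N\to\infty}\varphi\left(\left(\frac{\delta(s_1)+\dots+\delta(s_N)}{\sqrt N}\right)^{k}\right)=\begin{cases}0 & \text{if } k \text{ is odd},\\[2pt] \displaystyle\sum_{V\text{ a pair partition of }\{1,\dots,2r\}} p^{|I(V)|} & \text{if } k=2r \text{ is even}.\end{cases}$$ (Here $p^0=1$, also for $p=0$.) -/

import Mathlib

open MeasureTheory ProbabilityTheory Filter Topology

/-- The entry of a Coxeter matrix at an unordered pair of generators. -/
def CoxeterMatrix.pairEntry {S : Type*} (M : CoxeterMatrix S) : Sym2 S → ℕ :=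
  Sym2.lift ⟨fun s t => M s t, M.symmetric⟩

/-- `m` is a random Coxeter matrix over `S` with commutation probability `p`: its entries are
random variables, those above the diagonal (indexed by the unordered pairs of distinct generators)
are independent and identically distributed, and off the diagonal an entry is `2` with
probability `p` and lies in `{3, 4, …, ∞}` with probability `1 - p`.
In Mathlib's `CoxeterMatrix` (symmetric, `1` on the diagonal, never `1` off the diagonal)
the value `∞` is encoded as `0`. -/
structure IsRandomCoxeterMatrix {Ω S : Type*} [MeasurableSpace Ω] (P : Measure Ω) (p : ℝ)
    (m : Ω → CoxeterMatrix S) : Prop where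
  measurable : ∀ s t : S, Measurable fun ω => m ω s t
  indep : iIndepFun (fun (z : {z : Sym2 S // ¬ z.IsDiag}) (ω : Ω) => (m ω).pairEntry z) P
  identDistrib : ∀ s t s' t' : S, s ≠ t → s' ≠ t' →
    IdentDistrib (fun ω => m ω s t) (fun ω => m ω s' t') P P
  prob_two : ∀ s t : S, s ≠ t → P.real {ω | m ω s t = 2} = p
  prob_ge_three : ∀ s t : S, s ≠ t → P.real {ω | 3 ≤ m ω s t ∨ m ω s t = 0} = 1 - p

/-- The canonical trace `∑ a_x δ(x) ↦ a_1` on the complex group algebra of `G`. -/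
noncomputable def canonicalTrace (G : Type*) [Group G] (a : MonoidAlgebra ℂ G) : ℂ :=
  a.coeff 1

/-- `(δ(s₁) + ⋯ + δ(s_N)) / √N` in the group algebra of the Coxeter group of `M`, where
`s₁ = e 0, s₂ = e 1, …` is the enumeration of the generators. -/
noncomputable def normalizedSum {S : Type*} (e : ℕ ≃ S) (M : CoxeterMatrix S) (N : ℕ) :
    MonoidAlgebra ℂ M.Group :=
  ((Real.sqrt N : ℂ)⁻¹) • ∑ i ∈ Finset.range N, MonoidAlgebra.of ℂ M.Group (M.simple (e i))

/-- The pair partitions of a `k`-element linearly ordered set. -/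
def pairPartitions (k : ℕ) : Finset (Finpartition (Finset.univ : Finset (Fin k))) :=
  Finset.univ.filter fun V => ∀ A ∈ V.parts, A.card = 2

/-- The inversions of a pair partition: the ordered pairs of blocks `({e, f}, {e', f'})`
with `e < e' < f < f'`. -/
def inversions {k : ℕ} (V : Finpartition (Finset.univ : Finset (Fin k))) :
    Finset (Finset (Fin k) × Finset (Fin k)) :=
  (V.parts ×ˢ V.parts).filter fun AB =>
    ∃ e f e' f' : Fin k, AB.1 = {e, f} ∧ AB.2 = {e', f'} ∧ e < e' ∧ e' < f ∧ f < f'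

/-! Expanding the `k`-th power, the trace counts the words of length `k` in the first `N` generators
that represent the identity, divided by `N ^ (k / 2)` (`canonicalTrace_normalizedSum_pow`). A letter
occurring exactly once excludes the identity. Hence a trivial word that is not a pairing has fewer
than `k / 2` distinct letters, and such words are negligible (`card_nonpairings_mul_sqrt_le`).

The other words are injective labellings of the blocks of a pair partition `V`, and such a word is
trivial iff crossing blocks carry commuting labels (`wordProd_ofFn_block_eq_one_iff`). If they
commute, an innermost pair of equal letters cancels, and one inducts. For the converse, the
reflection representation is deformed: the Cartan entries at `(t, s)` and `(s, t)` are scaled by `c`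
and `c⁻¹`, which preserves the relations. If `s` and `t` cross in a trivial word, a matrix
coefficient shows that the entry at `(t, s)` cannot depend on `c`, so it vanishes and `M s t = 2`.

It remains to count injective copies of the crossing graph of `V` in the commutation graph, an
Erdős–Rényi graph. Copies without a common edge are uncorrelated, so the density has variance
`O(N⁻²)`. This is summable, and the density tends almost surely to `p ^ |I(V)|`
(`ae_tendsto_card_embedding_div`). -/

/-! ### Deformed reflection representations and nontrivial words -/

namespace CoxeterMatrix

variable {S : Type*}

/-- A real Cartan matrix compatible with the Coxeter matrix `M`; it need not be symmetric. -/
structure IsCartan (M : CoxeterMatrix S) (A : S → S → ℝ) : Prop where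
  diag : ∀ s, A s s = 2
  -- For `M s t = 0`, which encodes `∞`, the convention `π / 0 = 0` makes this product `4`.
  off_diag : ∀ s t, s ≠ t → A s t * A t s = (2 * Real.cos (Real.pi / M s t)) ^ 2
  -- A vanishing product would only force one of the two entries to be zero.
  commute : ∀ s t, M s t = 2 → A s t = 0

/-- The linear form `v ↦ ∑ a, A s a * v a`. -/
noncomputable def coroot (A : S → S → ℝ) (s : S) : Module.Dual ℝ (S →₀ ℝ) :=
  Finsupp.linearCombination ℝ (A s)

lemma coroot_single (A : S → S → ℝ) (s t : S) (c : ℝ) :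
    coroot A s (Finsupp.single t c) = c * A s t := by
  simp [coroot]

lemma coroot_congr {A B : S → S → ℝ} {s : S} {v : S →₀ ℝ} (h : ∀ t ∈ v.support, A s t = B s t) :
    coroot A s v = coroot B s v := by
  simp only [coroot, Finsupp.linearCombination_apply]
  exact Finsupp.sum_congr fun t ht => by rw [h t ht]

variable {M : CoxeterMatrix S} {A B : S → S → ℝ}

lemma IsCartan.coroot_self (hA : M.IsCartan A) (s : S) :
    coroot A s (Finsupp.single s 1) = 2 := by
  simp [coroot_single, hA.diag]

/-- The reflection attached to a generator by a Cartan matrix. -/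
noncomputable def IsCartan.refl (hA : M.IsCartan A) (s : S) : (S →₀ ℝ) ≃ₗ[ℝ] (S →₀ ℝ) :=
  Module.reflection (hA.coroot_self s)

lemma IsCartan.refl_apply (hA : M.IsCartan A) (s : S) (v : S →₀ ℝ) :
    hA.refl s v = v - coroot A s v • Finsupp.single s 1 :=
  Module.reflection_apply _ _

open Polynomial.Chebyshev in
lemma eval_S_two_mul_cos (n : ℤ) (θ : ℝ) :
    (Polynomial.Chebyshev.S ℝ n).eval (2 * Real.cos θ) * Real.sin θ = Real.sin ((n + 1) * θ) := by
  rw [← U_real_cos, ← S_comp_two_mul_X]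
  simp

/-- Powers of a product of two reflections are given by Chebyshev polynomials at `A s t * A t s - 2
= 2 cos (2π / n)`, so only the product of the entries matters. The polynomial factors vanish at this
angle. -/
lemma IsCartan.refl_mul_refl_pow (hA : M.IsCartan A) {s t : S} (hst : s ≠ t) :
    (hA.refl s * hA.refl t) ^ M s t = 1 := by
  ext1 z
  rcases Nat.lt_or_ge (M s t) 3 with h3 | h3
  · have h1 := M.off_diagonal s t hst
    have h02 : M s t = 0 ∨ M s t = 2 := by omega
    rcases h02 with h | h
    · simp [h]
    · have h1 := hA.commute s t h
      have h2 := hA.commute t s (by rw [M.symmetric, h])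
      rw [h, pow_two]
      simp only [LinearEquiv.mul_apply, hA.refl_apply, map_sub, map_smul, coroot_single, h1, h2,
        hA.diag, smul_eq_mul, LinearEquiv.coe_one, id]
      module
  · set n := M s t with hn
    have hn0 : (n : ℝ) ≠ 0 := by positivity
    set θ : ℝ := 2 * Real.pi / n with hθ
    have hsin : Real.sin θ ≠ 0 := by
      apply ne_of_gt
      apply Real.sin_pos_of_pos_of_lt_pi
      · positivity
      · rw [hθ, div_lt_iff₀ (by positivity)]
        have : (3 : ℝ) ≤ n := by exact_mod_cast h3
        nlinarith [Real.pi_pos]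
    have ht : 2 * Real.cos θ = coroot A s (Finsupp.single t 1) * coroot A t (Finsupp.single s 1)
        - 2 := by
      rw [coroot_single, coroot_single, one_mul, one_mul, hA.off_diag s t hst, hθ, mul_div_assoc,
        Real.cos_two_mul]
      ring
    have key := Module.reflection_mul_reflection_pow_apply (hA.coroot_self s) (hA.coroot_self t)
      n z (2 * Real.cos θ) ht
    change ((Module.reflection (hA.coroot_self s) * Module.reflection (hA.coroot_self t)) ^ n) z = z
    rw [key]
    have h0 : ∀ a : ℝ, a * Real.sin θ = 0 → a = 0 := fun a h => by simpa [hsin] using h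
    -- For `n = 2k` the factor is `S (k-1)`, zero because `k θ = π`. For `n = 2k + 1` it is `S k + S
    -- (k-1)`, zero because `(k + 1) θ + k θ = 2π`.
    obtain ⟨k, hk | hk⟩ := Nat.even_or_odd' n
    · have e1 : ((n : ℤ) - 2) / 2 = k - 1 := by omega
      have e2 : ((n : ℤ) - 1) / 2 = k - 1 := by omega
      have e3 : (Polynomial.Chebyshev.S ℝ ((k : ℤ) - 1)).eval (2 * Real.cos θ) = 0 := by
        apply h0
        rw [eval_S_two_mul_cos]
        have : (((k : ℤ) - 1 : ℤ) + 1 : ℝ) * θ = Real.pi := by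
          rw [hθ, hk]
          have : (k : ℝ) ≠ 0 := by rintro h; apply hn0; rw [hk]; simp [h]
          push_cast
          field_simp
          ring
        rw [this, Real.sin_pi]
      rw [e1, e2, e3]
      simp
    · have e1 : ((n : ℤ) - 2) / 2 = k - 1 := by omega
      have e2 : ((n : ℤ) - 1) / 2 = k := by omega
      have e4 : ((n : ℤ) - 3) / 2 = k - 1 := by omega
      have e5 : (n : ℤ) / 2 = k := by omega
      have e3 : (Polynomial.Chebyshev.S ℝ (k : ℤ)).eval (2 * Real.cos θ) +
          (Polynomial.Chebyshev.S ℝ ((k : ℤ) - 1)).eval (2 * Real.cos θ) = 0 := by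
        apply h0
        rw [add_mul, eval_S_two_mul_cos, eval_S_two_mul_cos]
        have : (((k : ℤ) - 1 : ℤ) + 1 : ℝ) * θ = 2 * Real.pi - (((k : ℤ) : ℝ) + 1) * θ := by
          rw [hθ]
          have h' : (n : ℝ) = 2 * k + 1 := by rw [hk]; push_cast; ring
          rw [h'] at hn0 ⊢
          push_cast
          field_simp
          ring
        rw [this, Real.sin_two_pi_sub]
        ring
      rw [e1, e2, e4, e5, e3]
      simp

lemma IsCartan.isLiftable (hA : M.IsCartan A) : M.IsLiftable hA.refl := by
  intro s t
  by_cases hst : s = t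
  · subst hst
    rw [M.diagonal, pow_one]
    ext1 z
    exact Module.involutive_reflection (hA.coroot_self s) z
  · exact hA.refl_mul_refl_pow hst

/-- The reflection representation of a Coxeter group attached to a Cartan matrix. -/
noncomputable def IsCartan.rep (hA : M.IsCartan A) : M.Group →* ((S →₀ ℝ) ≃ₗ[ℝ] (S →₀ ℝ)) :=
  M.toCoxeterSystem.lift ⟨hA.refl, hA.isLiftable⟩

lemma IsCartan.rep_simple (hA : M.IsCartan A) (s : S) (v : S →₀ ℝ) :
    hA.rep (M.simple s) v = v - coroot A s v • Finsupp.single s 1 := by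
  have := M.toCoxeterSystem.lift_apply_simple hA.isLiftable s
  rw [M.toCoxeterSystem_simple] at this
  rw [← hA.refl_apply, ← this]
  rfl

variable (M) in
/-- The element of the Coxeter group of `M` represented by a word. -/
def wordProd (w : List S) : M.Group := (w.map M.simple).prod

lemma simple_mul_simple_self (s : S) : M.simple s * M.simple s = 1 := by
  simpa [M.toCoxeterSystem_simple] using M.toCoxeterSystem.simple_mul_simple_self s

@[simp] lemma wordProd_nil : M.wordProd [] = 1 := by simp [wordProd]

@[simp] lemma wordProd_cons (s : S) (w : List S) :
    M.wordProd (s :: w) = M.simple s * M.wordProd w := by simp [wordProd]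

@[simp] lemma wordProd_append (w w' : List S) :
    M.wordProd (w ++ w') = M.wordProd w * M.wordProd w' := by simp [wordProd]

lemma wordProd_reverse (w : List S) : M.wordProd w.reverse = (M.wordProd w)⁻¹ := by
  induction w with
  | nil => simp
  | cons s w ih =>
    rw [List.reverse_cons, wordProd_append, wordProd_cons, wordProd_cons, wordProd_nil, mul_one, ih,
      mul_inv_rev, ← eq_inv_of_mul_eq_one_left (simple_mul_simple_self (M := M) s)]

lemma IsCartan.rep_simple_apply_of_ne (hA : M.IsCartan A) {s t : S} (h : t ≠ s) (v : S →₀ ℝ) :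
    hA.rep (M.simple s) v t = v t := by
  simp [hA.rep_simple, Finsupp.single_eq_of_ne h]

lemma IsCartan.rep_wordProd_apply_of_notMem (hA : M.IsCartan A) {w : List S} {t : S} (h : t ∉ w)
    (v : S →₀ ℝ) : hA.rep (M.wordProd w) v t = v t := by
  induction w with
  | nil => simp
  | cons s w ih =>
    rw [List.mem_cons, not_or] at h
    rw [wordProd_cons, map_mul, LinearEquiv.mul_apply, hA.rep_simple_apply_of_ne h.1, ih h.2]

lemma IsCartan.rep_wordProd_congr (hA : M.IsCartan A) (hB : M.IsCartan B) {w : List S}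
    (h : ∀ s ∈ w, A s = B s) (v : S →₀ ℝ) :
    hA.rep (M.wordProd w) v = hB.rep (M.wordProd w) v := by
  induction w with
  | nil => simp
  | cons s w ih =>
    rw [wordProd_cons, map_mul, map_mul, LinearEquiv.mul_apply, LinearEquiv.mul_apply,
      ih fun s hs => h s (List.mem_cons_of_mem _ hs), hA.rep_simple, hB.rep_simple,
      coroot_congr fun t _ => by rw [h s List.mem_cons_self]]

lemma IsCartan.rep_simple_self (hA : M.IsCartan A) (s : S) :
    hA.rep (M.simple s) (Finsupp.single s 1) = - Finsupp.single s 1 := by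
  rw [hA.rep_simple, hA.coroot_self]
  module

/-- The `t`-coordinate of the image of the root of `s` under a word with a single letter `t` and no
letter `s` is affine in the Cartan entry at `(t, s)`. -/
lemma IsCartan.rep_wordProd_add_entry (hA : M.IsCartan A) (hB : M.IsCartan B) {s t : S}
    (hst : s ≠ t) {u v : List S} (hu : t ∉ u) (hs : s ∉ v) (hv : t ∉ v)
    (hrow : ∀ a, a ≠ s → a ≠ t → A a = B a) (hentry : ∀ a, a ≠ s → A t a = B t a) :
    hA.rep (M.wordProd (u ++ t :: v)) (Finsupp.single s 1) t + A t s =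
      hB.rep (M.wordProd (u ++ t :: v)) (Finsupp.single s 1) t + B t s := by
  simp only [wordProd_append, wordProd_cons, map_mul, LinearEquiv.mul_apply]
  rw [hA.rep_wordProd_apply_of_notMem hu, hB.rep_wordProd_apply_of_notMem hu,
    hA.rep_wordProd_congr hB (w := v)
      fun a ha => hrow a (fun h => hs (h ▸ ha)) (fun h => hv (h ▸ ha))]
  -- Since `s` is not a letter of `v`, the root of `s` keeps coefficient `1`, which makes the slope
  -- in the entry at `(t, s)` constant.
  have hz : hB.rep (M.wordProd v) (Finsupp.single s 1) s = 1 := by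
    rw [hB.rep_wordProd_apply_of_notMem hs]; simp
  set z := hB.rep (M.wordProd v) (Finsupp.single s 1)
  have hdec : z = Finsupp.single s 1 + z.erase s := by
    rw [← hz, Finsupp.single_add_erase]
  have hc : coroot A t z - A t s = coroot B t z - B t s := by
    rw [hdec, map_add, map_add, coroot_single, coroot_single, one_mul, one_mul,
      add_sub_cancel_left, add_sub_cancel_left]
    refine coroot_congr fun a ha => hentry a ?_
    rintro rfl
    simp at ha
  simp only [hA.rep_simple, hB.rep_simple, Finsupp.sub_apply, Finsupp.smul_apply,
    Finsupp.single_eq_same, smul_eq_mul, mul_one]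
  linarith

open Classical in
/-- The standard Cartan matrix of a Coxeter matrix. -/
noncomputable def standardCartan (M : CoxeterMatrix S) (a b : S) : ℝ :=
  if a = b then 2 else -(2 * Real.cos (Real.pi / M a b))

lemma isCartan_standardCartan : M.IsCartan M.standardCartan where
  diag a := by simp [standardCartan]
  off_diag a b hab := by
    rw [standardCartan, standardCartan, if_neg hab, if_neg hab.symm, M.symmetric b a]
    ring
  commute a b h := by
    have hab : a ≠ b := by
      rintro rfl
      simp at h
    simp [standardCartan, hab, h]

open Classical in
/-- The standard Cartan matrix of `M`, rescaled by `c` at `(t, s)` and by `c⁻¹` at `(s, t)`. -/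
noncomputable def twistedCartan (M : CoxeterMatrix S) (s t : S) (c : ℝ) (a b : S) : ℝ :=
  M.standardCartan a b * (if a = t ∧ b = s then c else if a = s ∧ b = t then c⁻¹ else 1)

lemma isCartan_twistedCartan {s t : S} (hst : s ≠ t) {c : ℝ} (hc : c ≠ 0) :
    M.IsCartan (M.twistedCartan s t c) where
  diag a := by
    have h1 : ¬ (a = t ∧ a = s) := fun h => hst (h.2.symm.trans h.1)
    have h2 : ¬ (a = s ∧ a = t) := fun h => h1 h.symm
    rw [twistedCartan, if_neg h1, if_neg h2, isCartan_standardCartan.diag, mul_one]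
  off_diag a b hab := by
    rw [← isCartan_standardCartan.off_diag a b hab, twistedCartan, twistedCartan]
    by_cases h1 : a = t ∧ b = s
    · have : ¬ (b = t ∧ a = s) := fun h => hst (by rw [← h.2, h1.1])
      rw [if_pos h1, if_neg this, if_pos h1.symm]
      field_simp
    · by_cases h2 : a = s ∧ b = t
      · rw [if_neg h1, if_pos h2, if_pos h2.symm]
        field_simp
      · rw [if_neg h1, if_neg h2, if_neg (fun h => h2 h.symm), if_neg (fun h => h1 h.symm)]
        ring
  commute a b h := by rw [twistedCartan, isCartan_standardCartan.commute a b h, zero_mul]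

lemma cos_pi_div_ne_zero {s t : S} (hst : s ≠ t) (h2 : M s t ≠ 2) :
    Real.cos (Real.pi / M s t) ≠ 0 := by
  rcases Nat.lt_or_ge (M s t) 3 with h3 | h3
  · have h1 := M.off_diagonal s t hst
    have : M s t = 0 := by omega
    simp [this]
  · have h3' : (3 : ℝ) ≤ M s t := by exact_mod_cast h3
    apply ne_of_gt
    apply Real.cos_pos_of_mem_Ioo
    have hp := Real.pi_pos
    constructor
    · have : 0 < Real.pi / M s t := by positivity
      linarith
    · rw [div_lt_div_iff₀ (by positivity) (by positivity)]
      nlinarith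

lemma wordProd_append_comm_eq_one {u v : List S} (h : M.wordProd (u ++ v) = 1) :
    M.wordProd (v ++ u) = 1 := by
  rw [wordProd_append] at h ⊢
  exact mul_eq_one_comm.mp h

/-- A word with a letter that occurs exactly once does not represent the identity. -/
lemma wordProd_ne_one_of_append {s : S} {u v : List S} (hu : s ∉ u) (hv : s ∉ v) :
    M.wordProd (u ++ s :: v) ≠ 1 := by
  intro h
  have hA := isCartan_standardCartan (M := M)
  -- After rotation the lone `s` acts first and negates its root. The other letters do not touch the
  -- `s`-coordinate, so `-1 = 1`.
  have h1 : M.wordProd ((v ++ u) ++ [s]) = 1 := by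
    have := wordProd_append_comm_eq_one (u := u ++ [s]) (v := v) (by simpa using h)
    simpa [mul_assoc] using this
  have h2 := congrArg (fun g => hA.rep g (Finsupp.single s 1) s) h1
  simp only [wordProd_append (v ++ u), wordProd_cons, wordProd_nil, mul_one, map_mul,
    LinearEquiv.mul_apply, hA.rep_simple_self, map_one] at h2
  rw [hA.rep_wordProd_apply_of_notMem (by simp [hu, hv])] at h2
  simp at h2
  norm_num at h2

/-- If the two occurrences of `s` and of `t` cross in a word that represents the identity, then `s`
and `t` commute. -/
lemma eq_two_of_wordProd_eq_one {s t : S} (hst : s ≠ t) {u₁ u₂ u₃ u₄ : List S}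
    (hs : ∀ u ∈ [u₁, u₂, u₃, u₄], s ∉ u) (ht : ∀ u ∈ [u₁, u₂, u₃, u₄], t ∉ u)
    (h : M.wordProd (s :: (u₁ ++ t :: u₂) ++ s :: (u₃ ++ t :: u₄)) = 1) : M s t = 2 := by
  by_contra h2
  have hcos := cos_pi_div_ne_zero hst h2
  simp only [List.mem_cons, List.not_mem_nil, or_false, forall_eq_or_imp, forall_eq] at hs ht
  -- Any two distinct nonzero scalings would do.
  have hA := isCartan_twistedCartan (M := M) hst (c := 1) one_ne_zero
  have hB := isCartan_twistedCartan (M := M) hst (c := 2) two_ne_zero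
  have hrow : ∀ a, a ≠ s → a ≠ t → M.twistedCartan s t 1 a = M.twistedCartan s t 2 a := by
    intro a h1 h2
    funext b
    simp [twistedCartan, h1, h2]
  have hentry : ∀ a, a ≠ s → M.twistedCartan s t 1 t a = M.twistedCartan s t 2 t a := by
    intro a h1
    simp [twistedCartan, h1, hst.symm]
  have hx := hA.rep_wordProd_add_entry hB hst (u := u₁) (v := u₂) ht.1 hs.2.1 ht.2.1 hrow hentry
  have hy := hA.rep_wordProd_add_entry hB hst (u := u₄.reverse) (v := u₃.reverse) (by simp [ht])
    (by simp [hs]) (by simp [ht]) hrow hentry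
  have hrev : u₄.reverse ++ t :: u₃.reverse = (u₃ ++ t :: u₄).reverse := by simp
  rw [hrev] at hy
  have hrel : M.simple s * M.wordProd (u₁ ++ t :: u₂) =
      M.wordProd (u₃ ++ t :: u₄).reverse * M.simple s := by
    have hss : (M.simple s)⁻¹ = M.simple s :=
      (eq_inv_of_mul_eq_one_left (simple_mul_simple_self (M := M) s)).symm
    rw [wordProd_reverse]
    rw [wordProd_append (s :: _), wordProd_cons s, wordProd_cons s] at h
    rw [eq_inv_of_mul_eq_one_left h, mul_inv_rev, hss]
  have eval : ∀ {A : S → S → ℝ} (hA : M.IsCartan A),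
      hA.rep (M.wordProd (u₁ ++ t :: u₂)) (Finsupp.single s 1) t =
        - hA.rep (M.wordProd (u₃ ++ t :: u₄).reverse) (Finsupp.single s 1) t := by
    intro A hA
    have h1 := congrArg (fun g => hA.rep g (Finsupp.single s 1) t) hrel
    simpa only [map_mul, LinearEquiv.mul_apply, hA.rep_simple_apply_of_ne hst.symm,
      hA.rep_simple_self, map_neg, Finsupp.neg_apply] using h1
  -- The coefficients `x`, `y` of the two halves satisfy `x = -y`, while `x + A t s` and `y + A t s`
  -- are independent of `c`. Adding shows the same for `2 * A t s`.
  rw [eval hA, eval hB] at hx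
  have e : ∀ c, M.twistedCartan s t c t s = -(2 * Real.cos (Real.pi / M s t)) * c := by
    intro c
    simp [twistedCartan, standardCartan, hst.symm, M.symmetric t s]
  rw [e, e] at hx hy
  apply hcos
  linarith

end CoxeterMatrix

/-! ### Crossing letters and trivial words -/

namespace CoxeterMatrix

variable {S : Type*} {M : CoxeterMatrix S}

lemma simple_mul_comm {s t : S} (h : M s t = 2) :
    M.simple s * M.simple t = M.simple t * M.simple s := by
  have h1 := M.toCoxeterSystem.simple_mul_simple_pow s t
  rw [h, pow_two, M.toCoxeterSystem_simple] at h1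
  have hss : ∀ s, (M.simple s)⁻¹ = M.simple s := fun s =>
      (eq_inv_of_mul_eq_one_left (simple_mul_simple_self (M := M) s)).symm
  rw [eq_inv_of_mul_eq_one_left h1, mul_inv_rev, hss, hss]

/-- The repetition is innermost: any letter of `x` that occurs twice in `w` has its other occurrence
outside `s x s`. -/
lemma exists_minimal_repetition {w : List S} (h : ¬ w.Nodup) :
    ∃ (u x v : List S) (s : S), w = u ++ s :: (x ++ s :: v) ∧ x.Nodup ∧ s ∉ x := by
  induction w with
  | nil => simp at h
  | cons b w ih =>
    by_cases hw : w.Nodup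
    · have hb : b ∈ w := by
        by_contra hb
        exact h (List.nodup_cons.mpr ⟨hb, hw⟩)
      obtain ⟨x, v, rfl⟩ := List.append_of_mem hb
      refine ⟨[], x, v, b, rfl, hw.of_append_left, fun hx => ?_⟩
      exact (List.nodup_append.mp hw).2.2 b hx b (by simp) rfl
    · obtain ⟨u, x, v, s, rfl, h1, h2⟩ := ih hw
      exact ⟨b :: u, x, v, s, rfl, h1, h2⟩

variable [DecidableEq S]

lemma wordProd_ne_one_of_count_eq_one {w : List S} {s : S} (h : w.count s = 1) :
    M.wordProd w ≠ 1 := by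
  obtain ⟨u, v, rfl⟩ := List.append_of_mem (List.count_pos_iff.mp (by omega : 0 < w.count s))
  simp only [List.count_append, List.count_cons_self] at h
  exact wordProd_ne_one_of_append (List.count_eq_zero.mp (by omega))
    (List.count_eq_zero.mp (by omega))

/-- Triviality is invariant under rotation, so the word may start at the first `s`. The count bounds
keep `s` and `t` out of the gaps. -/
lemma eq_two_of_sublist {w : List S} {s t : S} (hst : s ≠ t) (hs : w.count s ≤ 2)
    (ht : w.count t ≤ 2) (hsub : [s, t, s, t].Sublist w) (h : M.wordProd w = 1) : M s t = 2 := by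
  obtain ⟨r₁, w₁, rfl, m₁, hsub⟩ := List.cons_sublist_iff.mp hsub
  obtain ⟨r₂, w₂, rfl, m₂, hsub⟩ := List.cons_sublist_iff.mp hsub
  obtain ⟨r₃, w₃, rfl, m₃, hsub⟩ := List.cons_sublist_iff.mp hsub
  obtain ⟨r₄, w₄, rfl, m₄, -⟩ := List.cons_sublist_iff.mp hsub
  obtain ⟨p₁, q₁, rfl⟩ := List.append_of_mem m₁
  obtain ⟨p₂, q₂, rfl⟩ := List.append_of_mem m₂
  obtain ⟨p₃, q₃, rfl⟩ := List.append_of_mem m₃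
  obtain ⟨p₄, q₄, rfl⟩ := List.append_of_mem m₄
  simp only [List.count_append, List.count_cons_self, List.count_cons_of_ne hst,
    List.count_cons_of_ne hst.symm] at hs ht
  refine eq_two_of_wordProd_eq_one (M := M) hst (u₁ := q₁ ++ p₂) (u₂ := q₂ ++ p₃)
    (u₃ := q₃ ++ p₄) (u₄ := q₄ ++ w₄ ++ p₁) ?_ ?_ ?_
  · simp only [List.mem_cons, List.not_mem_nil, or_false, forall_eq_or_imp, forall_eq,
      List.mem_append]
    simp only [← List.count_pos_iff]
    omega
  · simp only [List.mem_cons, List.not_mem_nil, or_false, forall_eq_or_imp, forall_eq,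
      List.mem_append]
    simp only [← List.count_pos_iff]
    omega
  · have := wordProd_append_comm_eq_one (M := M) (u := p₁)
      (v := s :: q₁ ++ (p₂ ++ t :: q₂ ++ (p₃ ++ s :: q₃ ++ (p₄ ++ t :: q₄ ++ w₄)))) (by simpa using h)
    simpa [mul_assoc] using this

/-- A word in which every letter occurs zero or two times and in which any two crossing letters
commute represents the identity. -/
lemma wordProd_eq_one_of_sublist (w : List S) (hcount : ∀ s ∈ w, w.count s = 2)
    (hcomm : ∀ s t, s ≠ t → [s, t, s, t].Sublist w → M s t = 2) : M.wordProd w = 1 := by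
  induction hn : w.length using Nat.strong_induction_on generalizing w with
  | _ n ih =>
  rcases List.eq_nil_or_concat w with rfl | ⟨w', b, rfl⟩
  · simp
  have hnd : ¬ (w' ++ [b]).Nodup := fun hnd => by
    have h1 := hcount b (by simp)
    have h2 := List.nodup_iff_count_le_one.mp hnd b
    rw [List.concat_eq_append] at h1
    omega
  rw [List.concat_eq_append] at *
  obtain ⟨u, x, v, s, hw, hx, hsx⟩ := exists_minimal_repetition hnd
  rw [hw] at hcount hcomm hn ⊢
  have hsub : (u ++ (x ++ v)).Sublist (u ++ s :: (x ++ s :: v)) :=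
    List.Sublist.append_left (((List.sublist_cons_self s v).append_left x).cons s) u
  have hcs : u.count s + v.count s = 0 := by
    have := hcount s (by simp)
    simp only [List.count_append, List.count_cons_self] at this
    omega
  -- The second `c` lies in `u` or in `v`, so `c` crosses `s`.
  have hxcomm : ∀ c ∈ x, M s c = 2 := by
    intro c hc
    have hsc : s ≠ c := fun h => hsx (h ▸ hc)
    have h1 := hcount c (by simp [hc])
    have h2 : x.count c = 1 := List.count_eq_one_of_mem hx hc
    simp only [List.count_append, List.count_cons_of_ne hsc] at h1
    have h3 : 0 < u.count c ∨ 0 < v.count c := by omega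
    rcases h3 with h3 | h3
    · rw [M.symmetric]
      apply hcomm c s hsc.symm
      have a1 := List.singleton_sublist.mpr (List.count_pos_iff.mp h3)
      have a2 := List.singleton_sublist.mpr hc
      have := a1.append ((a2.append ((List.nil_sublist v).cons_cons s)).cons_cons s)
      simpa using this
    · apply hcomm s c hsc
      have a1 := List.singleton_sublist.mpr (List.count_pos_iff.mp h3)
      have a2 := List.singleton_sublist.mpr hc
      have := (List.nil_sublist u).append ((a2.append (a1.cons_cons s)).cons_cons s)
      simpa using this
  have hred : M.wordProd (u ++ (x ++ v)) = 1 := by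
    refine ih _ ?_ _ ?_ ?_ rfl
    · rw [← hn]
      simp
    · intro c hc
      have h1 := hcount c (hsub.subset hc)
      have hsc : s ≠ c := by
        rintro rfl
        have := List.count_pos_iff.mpr hc
        simp only [List.count_append, List.count_eq_zero_of_not_mem hsx] at this
        omega
      simpa [List.count_append, List.count_cons_of_ne hsc] using h1
    · exact fun a b hab h => hcomm a b hab (h.trans hsub)
  have hcx : M.simple s * M.wordProd x = M.wordProd x * M.simple s := by
    clear hn hcomm hcount hw hsub hred hx hsx
    induction x with
    | nil => simp
    | cons c x ih' =>
      rw [wordProd_cons, ← mul_assoc, simple_mul_comm (hxcomm c (by simp)), mul_assoc,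
        ih' (fun c hc => hxcomm c (by simp [hc])), mul_assoc]
  rw [← hred]
  simp only [wordProd_append, wordProd_cons]
  rw [← mul_assoc (M.simple s), hcx, mul_assoc, ← mul_assoc (M.simple s) (M.simple s),
    simple_mul_simple_self, one_mul]

end CoxeterMatrix

/-! ### Subgraph densities in a random graph -/

section Probability

variable {Ω : Type*} [MeasurableSpace Ω] {P : Measure Ω}

/-- By Tonelli `∑ X n ^ 2` has finite expectation, so it converges almost surely. -/
lemma ae_tendsto_zero_of_summable_integral_sq {X : ℕ → Ω → ℝ}
    (hX : ∀ n, Measurable (X n)) (hint : ∀ n, Integrable (fun ω => X n ω ^ 2) P) {b : ℕ → ℝ}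
    (hb : Summable b) (hle : ∀ n, ∫ ω, X n ω ^ 2 ∂P ≤ b n) :
    ∀ᵐ ω ∂P, Tendsto (fun n => X n ω) atTop (𝓝 0) := by
  have hmeas : ∀ n, Measurable fun ω => ENNReal.ofReal (X n ω ^ 2) := fun n =>
    ((hX n).pow_const 2).ennreal_ofReal
  have hfin : ∫⁻ ω, ∑' n, ENNReal.ofReal (X n ω ^ 2) ∂P ≠ ⊤ := by
    rw [lintegral_tsum fun n => (hmeas n).aemeasurable]
    refine ne_top_of_le_ne_top hb.tsum_ofReal_ne_top (ENNReal.tsum_le_tsum fun n => ?_)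
    rw [← ofReal_integral_eq_lintegral_ofReal (hint n) (ae_of_all _ fun ω => sq_nonneg _)]
    exact ENNReal.ofReal_le_ofReal (hle n)
  filter_upwards [ae_lt_top (Measurable.tsum hmeas) hfin] with ω hω
  have h1 := ENNReal.tendsto_atTop_zero_of_tsum_ne_top hω.ne
  have h2 := (ENNReal.tendsto_toReal ENNReal.zero_ne_top).comp h1
  have h3 : Tendsto (fun n => X n ω ^ 2) atTop (𝓝 0) := by
    refine h2.congr fun n => ?_
    simp [ENNReal.toReal_ofReal (sq_nonneg (X n ω))]
  have h4 := (Real.continuous_sqrt.tendsto 0).comp h3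
  rw [Real.sqrt_zero] at h4
  refine (tendsto_zero_iff_abs_tendsto_zero _).mpr (h4.congr fun n => ?_)
  simp [Real.sqrt_sq_eq_abs]

/-- Overwriting the two prescribed values by arbitrary ones is injective. -/
lemma card_filter_apply_eq_mul_sq_le {α β : Type*} [Fintype α] [DecidableEq α] [Fintype β]
    [DecidableEq β] {c d : α} (hcd : c ≠ d) (u v : β) :
    (Finset.univ.filter fun h : α → β => h c = u ∧ h d = v).card * Fintype.card β ^ 2 ≤
      Fintype.card β ^ Fintype.card α := by
  have hinj : Set.InjOn
      (fun x : (α → β) × β × β => Function.update (Function.update x.1 c x.2.1) d x.2.2)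
      ((Finset.univ.filter fun h : α → β => h c = u ∧ h d = v) ×ˢ
        (Finset.univ : Finset (β × β)) : Finset ((α → β) × β × β)) := by
    rintro ⟨h, y, z⟩ hx ⟨h', y', z'⟩ hx' heq
    simp only [Finset.coe_product, Set.mem_prod, Finset.mem_coe, Finset.mem_filter,
      Finset.mem_univ, true_and, and_true] at hx hx'
    have hz : z = z' := by simpa using congrFun heq d
    have hy : y = y' := by simpa [hcd] using congrFun heq c
    have hh : h = h' := by
      funext x
      by_cases hxc : x = c
      · rw [hxc, hx.1, hx'.1]
      · by_cases hxd : x = d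
        · rw [hxd, hx.2, hx'.2]
        · simpa [hxc, hxd] using congrFun heq x
    rw [hz, hy, hh]
  have := Finset.card_le_card_of_injOn _ (t := Finset.univ) (fun _ _ => Finset.mem_univ _) hinj
  rwa [Finset.card_product, Finset.card_univ, Finset.card_univ, Fintype.card_prod, Fintype.card_fun,
    ← pow_two] at this

open Classical in
/-- The number of pairs of injective labellings of the vertices of a graph under which some edge
receives the same labels is at most of order `N ^ (2 * r - 2)`. -/
lemma card_overlapping_mul_sq_le {α : Type*} [Fintype α] (E : Finset (Sym2 α))
    (hE : ∀ z ∈ E, ¬ z.IsDiag) (N : ℕ) :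
    (Finset.univ.filter fun L : (α ↪ Fin N) × (α ↪ Fin N) =>
      ¬ Disjoint (E.image (Sym2.map fun a => (L.1 a : ℕ)))
        (E.image (Sym2.map fun a => (L.2 a : ℕ)))).card * N ^ 2 ≤
      Fintype.card α ^ 4 * N ^ (2 * Fintype.card α) := by
  -- A common edge means that the second labelling takes at `c ≠ d` the values of the first at some
  -- `a`, `b`. For each choice of these vertices two values are determined, which saves `N ^ 2`.
  set I : Finset ((α × α) × (α × α)) := Finset.univ.filter fun x => x.2.1 ≠ x.2.2
  let T : (α × α) × (α × α) → Finset ((α → Fin N) × (α → Fin N)) := fun x =>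
    Finset.univ.filter fun g => g.2 x.2.1 = g.1 x.1.1 ∧ g.2 x.2.2 = g.1 x.1.2
  have h1 : (Finset.univ.filter fun L : (α ↪ Fin N) × (α ↪ Fin N) =>
      ¬ Disjoint (E.image (Sym2.map fun a => (L.1 a : ℕ)))
        (E.image (Sym2.map fun a => (L.2 a : ℕ)))).card ≤ (I.biUnion T).card := by
    refine Finset.card_le_card_of_injOn (fun L => (⇑L.1, ⇑L.2)) ?_ ?_
    · rintro ⟨L, L'⟩ hL
      simp only [Finset.coe_filter, Finset.mem_univ, true_and, Set.mem_ofPred_eq,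
        Finset.not_disjoint_iff, Finset.mem_image] at hL
      obtain ⟨_, ⟨z, hz, rfl⟩, z', hz', heq⟩ := hL
      induction z using Sym2.ind with | _ a b =>
      induction z' using Sym2.ind with | _ c d =>
      have hcd : c ≠ d := hE _ hz'
      simp only [Sym2.map_mk, Sym2.eq_iff, Fin.val_inj] at heq
      simp only [Finset.coe_biUnion, Set.mem_iUnion, Finset.mem_coe]
      rcases heq with heq | heq
      · exact ⟨((a, b), (c, d)), by simpa [I] using hcd, by simpa [T] using heq⟩
      · exact ⟨((b, a), (c, d)), by simpa [I] using hcd, by simpa [T] using heq⟩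
    · rintro ⟨L, L'⟩ - ⟨K, K'⟩ - h
      simpa using h
  have h2 : ∀ x ∈ I, (T x).card * N ^ 2 ≤ N ^ (2 * Fintype.card α) := by
    rintro ⟨⟨a, b⟩, ⟨c, d⟩⟩ hx
    have hcd : c ≠ d := by simpa [I] using hx
    have h3 : (T ((a, b), (c, d))).card =
        ∑ g : α → Fin N, (Finset.univ.filter fun h : α → Fin N => h c = g a ∧ h d = g b).card := by
      simp only [T, Finset.card_filter]
      rw [Fintype.sum_prod_type]
    rw [h3, Finset.sum_mul]
    calc _ ≤ ∑ g : α → Fin N, N ^ Fintype.card α := by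
          refine Finset.sum_le_sum fun g _ => ?_
          simpa using card_filter_apply_eq_mul_sq_le hcd (g a) (g b)
      _ = N ^ (2 * Fintype.card α) := by
          simp [two_mul, pow_add]
  calc _ ≤ (I.biUnion T).card * N ^ 2 := Nat.mul_le_mul_right _ h1
    _ ≤ (∑ x ∈ I, (T x).card) * N ^ 2 := Nat.mul_le_mul_right _ Finset.card_biUnion_le
    _ = ∑ x ∈ I, (T x).card * N ^ 2 := Finset.sum_mul ..
    _ ≤ ∑ x ∈ I, N ^ (2 * Fintype.card α) := Finset.sum_le_sum h2
    _ = I.card * N ^ (2 * Fintype.card α) := by simp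
    _ ≤ _ := by
        refine Nat.mul_le_mul_right _ ((Finset.card_le_univ I).trans_eq ?_)
        simp only [Fintype.card_prod]
        ring

open Classical in
/-- A bound for the variance of the number of events that occur among events of the same
probability, which are not positively correlated except for the pairs in `B`. -/
lemma integral_sq_sum_indicator_sub_le [IsProbabilityMeasure P] {ι : Type*} [Fintype ι]
    (ev : ι → Set Ω) (hev : ∀ i, MeasurableSet (ev i)) {q : ℝ} (hq : ∀ i, P.real (ev i) = q)
    (B : Finset (ι × ι)) (hB : ∀ i j, (i, j) ∉ B → P.real (ev i ∩ ev j) ≤ q ^ 2) :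
    ∫ ω, (∑ i, ((ev i).indicator 1 ω - q)) ^ 2 ∂P ≤ B.card := by
  have hI : ∀ s : Set Ω, MeasurableSet s → Integrable (s.indicator (1 : Ω → ℝ)) P := fun s hs =>
    (integrable_const (1 : ℝ)).indicator hs
  have hexp : ∀ i j, (fun ω => ((ev i).indicator (1 : Ω → ℝ) ω - q) * ((ev j).indicator 1 ω - q)) =
      fun ω => ((ev i ∩ ev j).indicator (1 : Ω → ℝ) ω - q * (ev i).indicator (1 : Ω → ℝ) ω) -
        (q * (ev j).indicator (1 : Ω → ℝ) ω - q ^ 2) := by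
    intro i j
    funext ω
    have := congrFun (Set.inter_indicator_one (M₀ := ℝ) (s := ev i) (t := ev j)) ω
    rw [this, Pi.mul_apply]
    ring
  have hint : ∀ i j, Integrable
      (fun ω => ((ev i).indicator (1 : Ω → ℝ) ω - q) * ((ev j).indicator 1 ω - q)) P := by
    intro i j
    rw [hexp]
    exact ((hI _ ((hev i).inter (hev j))).sub ((hI _ (hev i)).const_mul q)).sub
      (((hI _ (hev j)).const_mul q).sub (integrable_const _))
  have hval : ∀ i j, ∫ ω, ((ev i).indicator (1 : Ω → ℝ) ω - q) * ((ev j).indicator 1 ω - q) ∂P =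
      P.real (ev i ∩ ev j) - q ^ 2 := by
    intro i j
    have h1 := hI _ ((hev i).inter (hev j))
    have h2 := (hI _ (hev i)).const_mul q
    have h3 := (hI _ (hev j)).const_mul q
    have h4 : Integrable (fun ω => (ev i ∩ ev j).indicator (1 : Ω → ℝ) ω -
      q * (ev i).indicator (1 : Ω → ℝ) ω) P := h1.sub h2
    have h5 : Integrable (fun ω => q * (ev j).indicator (1 : Ω → ℝ) ω - q ^ 2) P :=
      h3.sub (integrable_const _)
    rw [hexp, integral_sub h4 h5, integral_sub h1 h2,
      integral_sub h3 (integrable_const _), integral_const_mul, integral_const_mul,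
      integral_indicator_one ((hev i).inter (hev j)), integral_indicator_one (hev i),
      integral_indicator_one (hev j), hq, hq, integral_const]
    simp
    ring
  simp_rw [pow_two, Finset.sum_mul_sum]
  rw [integral_finsetSum _ fun i _ => integrable_finsetSum _ fun j _ => hint i j]
  simp_rw [integral_finsetSum _ fun j _ => hint _ j, hval]
  rw [← Fintype.sum_prod_type' (f := fun i j => P.real (ev i ∩ ev j) - q ^ 2)]
  -- A covariance is at most `1` on `B` and nonpositive off `B`.
  calc _ ≤ ∑ x : ι × ι, if x ∈ B then (1 : ℝ) else 0 := by
        refine Finset.sum_le_sum fun x _ => ?_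
        split_ifs with hx
        · have : P.real (ev x.1 ∩ ev x.2) ≤ 1 := measureReal_le_one
          nlinarith [sq_nonneg q]
        · linarith [hB x.1 x.2 hx]
    _ = B.card := by simp

open Classical in
/-- The density of injective copies of a fixed finite graph in an Erdős–Rényi random graph on the
natural numbers converges almost surely. -/
theorem ae_tendsto_card_embedding_div [IsProbabilityMeasure P] {α : Type*} [Fintype α]
    (E : Finset (Sym2 α)) (hE : ∀ z ∈ E, ¬ z.IsDiag) {A : Sym2 ℕ → Set Ω} {p : ℝ}
    (hmeas : ∀ z, ¬ z.IsDiag → MeasurableSet (A z))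
    (hA : ∀ F : Finset (Sym2 ℕ), (∀ z ∈ F, ¬ z.IsDiag) → P.real (⋂ z ∈ F, A z) = p ^ F.card) :
    ∀ᵐ ω ∂P, Tendsto (fun N : ℕ =>
      ((Finset.univ.filter fun L : α ↪ Fin N => ∀ z ∈ E, ω ∈ A (z.map fun a => (L a : ℕ))).card : ℝ)
        / (N : ℝ) ^ Fintype.card α) atTop (𝓝 (p ^ E.card)) := by
  let F : ∀ {N : ℕ}, (α ↪ Fin N) → Finset (Sym2 ℕ) := fun L =>
    E.image (Sym2.map fun a => (L a : ℕ))
  have hinj : ∀ {N : ℕ} (L : α ↪ Fin N), Function.Injective fun a => (L a : ℕ) := fun L =>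
    Fin.val_injective.comp L.injective
  have hFdiag : ∀ {N : ℕ} (L : α ↪ Fin N), ∀ z ∈ F L, ¬ z.IsDiag := by
    intro N L z hz
    obtain ⟨z, hzE, rfl⟩ := Finset.mem_image.mp hz
    rw [Sym2.isDiag_map (hinj L)]
    exact hE z hzE
  have hFcard : ∀ {N : ℕ} (L : α ↪ Fin N), (F L).card = E.card := fun L =>
    Finset.card_image_of_injective _ (Sym2.map.injective (hinj L))
  let ev : ∀ {N : ℕ}, (α ↪ Fin N) → Set Ω := fun L => ⋂ z ∈ F L, A z
  have hev : ∀ {N : ℕ} (L : α ↪ Fin N), MeasurableSet (ev L) := fun L =>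
    Finset.measurableSet_biInter _ fun z hz => hmeas z (hFdiag L z hz)
  have hq : ∀ {N : ℕ} (L : α ↪ Fin N), P.real (ev L) = p ^ E.card := fun L => by
    rw [hA _ (hFdiag L), hFcard]
  have hinter : ∀ {N : ℕ} (L L' : α ↪ Fin N), Disjoint (F L) (F L') →
      P.real (ev L ∩ ev L') ≤ (p ^ E.card) ^ 2 := by
    intro N L L' hd
    have : ev L ∩ ev L' = ⋂ z ∈ F L ∪ F L', A z := by
      ext ω
      simp only [ev, Set.mem_inter_iff, Set.mem_iInter, Finset.mem_union, or_imp, forall_and]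
    rw [this, hA, Finset.card_union_of_disjoint hd, hFcard, hFcard, pow_add, pow_two]
    intro z hz
    rcases Finset.mem_union.mp hz with hz | hz
    exacts [hFdiag L z hz, hFdiag L' z hz]
  set r := Fintype.card α with hr
  let X : ℕ → Ω → ℝ := fun N ω =>
    (∑ L : α ↪ Fin N, ((ev L).indicator (1 : Ω → ℝ) ω - p ^ E.card)) / (N : ℝ) ^ r
  have hXmeas : ∀ N, Measurable (X N) := fun N =>
    (Finset.measurable_sum _ fun L _ =>
      (measurable_one.indicator (hev L)).sub measurable_const).div_const _
  have hXint : ∀ N, Integrable (fun ω => X N ω ^ 2) P := by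
    intro N
    have hm : MemLp (X N) 2 P := by
      have : MemLp (fun ω => ∑ L : α ↪ Fin N, ((ev L).indicator (1 : Ω → ℝ) ω - p ^ E.card)) 2 P :=
        memLp_finsetSum _ fun L _ =>
          ((memLp_const (1 : ℝ)).indicator (hev L)).sub (memLp_const _)
      simpa only [X, div_eq_inv_mul] using this.const_mul ((N : ℝ) ^ r)⁻¹
    exact hm.integrable_sq
  -- The shift to `N + 1` avoids dividing by zero.
  have hXle : ∀ N, ∫ ω, X (N + 1) ω ^ 2 ∂P ≤ (r : ℝ) ^ 4 * (1 / ((N + 1 : ℕ) : ℝ) ^ 2) := by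
    intro N
    have h1 := integral_sq_sum_indicator_sub_le (P := P) (ι := α ↪ Fin (N + 1)) ev hev hq
      (Finset.univ.filter fun L => ¬ Disjoint (F L.1) (F L.2))
      fun L L' h => hinter L L' (by simpa using h)
    have h2 := card_overlapping_mul_sq_le E hE (N + 1)
    have h2' := (Nat.cast_le (α := ℝ)).mpr h2
    push_cast at h2'
    simp only [X, div_pow]
    rw [integral_div, div_le_iff₀ (by positivity), mul_one_div, div_mul_eq_mul_div,
      le_div_iff₀ (by positivity)]
    refine (mul_le_mul_of_nonneg_right h1 (by positivity)).trans ?_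
    rw [← pow_mul, mul_comm r 2]
    push_cast
    exact h2'
  have hsum : Summable fun N : ℕ => (r : ℝ) ^ 4 * (1 / ((N + 1 : ℕ) : ℝ) ^ 2) :=
    ((summable_nat_add_iff 1 (f := fun N : ℕ => 1 / (N : ℝ) ^ 2)).mpr
      (Real.summable_one_div_nat_pow.mpr one_lt_two)).mul_left _
  filter_upwards [ae_tendsto_zero_of_summable_integral_sq (fun N => hXmeas (N + 1))
    (fun N => hXint (N + 1)) hsum hXle] with ω hω
  rw [tendsto_add_atTop_iff_nat (f := fun N => X N ω)] at hω
  -- This handles the mean: there are `N.descFactorial r` labellings, asymptotically `N ^ r`.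
  have hdesc : Tendsto (fun N : ℕ => (N.descFactorial r : ℝ) / (N : ℝ) ^ r) atTop (𝓝 1) := by
    have := isEquivalent_descFactorial r
    rw [Asymptotics.isEquivalent_iff_tendsto_one] at this
    · exact this
    · filter_upwards [eventually_gt_atTop 0] with N hN
      positivity
  have := hω.add (hdesc.mul_const (p ^ E.card))
  rw [zero_add, one_mul] at this
  refine this.congr fun N => ?_
  have hcount : ((Finset.univ.filter fun L : α ↪ Fin N =>
      ∀ z ∈ E, ω ∈ A (z.map fun a => (L a : ℕ))).card : ℝ) =
      ∑ L : α ↪ Fin N, (ev L).indicator (1 : Ω → ℝ) ω := by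
    rw [Finset.card_filter, Nat.cast_sum]
    refine Finset.sum_congr rfl fun L _ => ?_
    simp [ev, F, Set.indicator_apply]
  simp only [X]
  rw [hcount, Finset.sum_sub_distrib, Finset.sum_const, Finset.card_univ,
    Fintype.card_embedding_eq, Fintype.card_fin, nsmul_eq_mul]
  ring

end Probability

/-! ### Words as functions on positions -/

section Words

variable {S : Type*}

lemma count_ofFn_eq_card [DecidableEq S] {k : ℕ} (f : Fin k → S) (s : S) :
    (List.ofFn f).count s = (Finset.univ.filter fun x => f x = s).card := by
  rw [← Multiset.coe_count, ← Fin.univ_val_map, Multiset.count_map, ← Finset.filter_val,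
    Finset.card_val]
  simp [eq_comm]

lemma alternating_sublist_ofFn_iff {k : ℕ} (f : Fin k → S) (s t : S) :
    [s, t, s, t].Sublist (List.ofFn f) ↔
      ∃ x y x' y', x < y ∧ y < x' ∧ x' < y' ∧ f x = s ∧ f y = t ∧ f x' = s ∧ f y' = t := by
  rw [List.ofFn_eq_map]
  constructor
  · intro h
    obtain ⟨l, hl, hmap⟩ := List.sublist_map_iff.mp h
    have hlt := (List.pairwise_lt_finRange k).sublist hl
    obtain ⟨x, l, rfl, rfl, hm₁⟩ := List.map_eq_cons_iff.mp hmap.symm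
    obtain ⟨y, l, rfl, rfl, hm₂⟩ := List.map_eq_cons_iff.mp hm₁
    obtain ⟨x', l, rfl, hx, hm₃⟩ := List.map_eq_cons_iff.mp hm₂
    obtain ⟨y', l, rfl, hy, -⟩ := List.map_eq_cons_iff.mp hm₃
    simp only [List.pairwise_cons, List.mem_cons, forall_eq_or_imp] at hlt
    exact ⟨x, y, x', y', hlt.1.1, hlt.2.1.1, hlt.2.2.1.1, rfl, rfl, hx, hy⟩
  · rintro ⟨x, y, x', y', h1, h2, h3, rfl, rfl, hx, hy⟩
    have hsub : [x, y, x', y'].Sublist (List.finRange k) := by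
      have hp : [x, y, x', y'].Pairwise (· < ·) := by
        simp [h1, h2, h3, h1.trans h2, h2.trans h3, (h1.trans h2).trans h3]
      refine List.sublist_of_subperm_of_pairwise (r := (· < ·)) ?_ hp (List.pairwise_lt_finRange k)
      exact List.subperm_of_subset (hp.imp fun h => h.ne) fun _ _ => List.mem_finRange _
    simpa [hx, hy] using hsub.map f

end Words

/-! ### Pair partitions and their crossing graphs -/

section PairPartitions

variable {k : ℕ} {V : Finpartition (Finset.univ : Finset (Fin k))}

lemma mem_pairPartitions : V ∈ pairPartitions k ↔ ∀ A ∈ V.parts, A.card = 2 := by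
  simp [pairPartitions]

lemma two_mul_card_parts (hV : V ∈ pairPartitions k) : 2 * V.parts.card = k := by
  have := V.sum_card_parts
  rw [Finset.sum_congr rfl (mem_pairPartitions.mp hV)] at this
  simpa [mul_comm] using this

/-- The block of a partition of `Fin k` that contains a given element. -/
def Finpartition.block (V : Finpartition (Finset.univ : Finset (Fin k))) (x : Fin k) :
    V.parts :=
  ⟨V.part x, V.part_mem.2 (Finset.mem_univ x)⟩

lemma Finpartition.block_eq_iff {x : Fin k} {A : V.parts} : V.block x = A ↔ x ∈ A.1 := by
  rw [Subtype.ext_iff]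
  exact V.part_eq_iff_mem A.2

lemma Finpartition.exists_block_eq (A : V.parts) : ∃ x, V.block x = A := by
  obtain ⟨x, hx⟩ := V.nonempty_of_mem_parts A.2
  exact ⟨x, Finpartition.block_eq_iff.mpr hx⟩

lemma Finpartition.mem_part_iff_block_eq {x y : Fin k} : y ∈ V.part x ↔ V.block y = V.block x :=
  (Finpartition.block_eq_iff (A := V.block x)).symm

lemma card_filter_block_eq (hV : V ∈ pairPartitions k) (A : V.parts) :
    (Finset.univ.filter fun x => V.block x = A).card = 2 := by
  rw [← mem_pairPartitions.mp hV A.1 A.2]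
  congr 1
  ext x
  simp [Finpartition.block_eq_iff]

lemma mem_inversions {A B : Finset (Fin k)} : (A, B) ∈ inversions V ↔ A ∈ V.parts ∧ B ∈ V.parts ∧
    ∃ e f e' f' : Fin k, A = {e, f} ∧ B = {e', f'} ∧ e < e' ∧ e' < f ∧ f < f' := by
  simp [inversions, and_assoc]

/-- The first block of an inversion has the smaller minimum. So inversions correspond to edges of a
simple graph on the blocks. -/
lemma swap_notMem_inversions {A B : Finset (Fin k)} (h : (A, B) ∈ inversions V) :
    (B, A) ∉ inversions V := by
  intro h'
  obtain ⟨-, -, e, f, e', f', rfl, rfl, h1, h2, h3⟩ := mem_inversions.mp h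
  obtain ⟨-, -, a, b, a', b', hB, hA, h4, h5, h6⟩ := mem_inversions.mp h'
  have m1 : e ∈ ({a', b'} : Finset (Fin k)) := hA ▸ by simp
  have m2 : a ∈ ({e', f'} : Finset (Fin k)) := hB ▸ by simp
  simp only [Finset.mem_insert, Finset.mem_singleton] at m1 m2
  omega

/-- The unordered pairs of crossing blocks. -/
def crossingPairs (V : Finpartition (Finset.univ : Finset (Fin k))) : Finset (Sym2 V.parts) :=
  (inversions V).attach.image fun AB =>
    s(⟨AB.1.1, (mem_inversions.mp AB.2).1⟩, ⟨AB.1.2, (mem_inversions.mp AB.2).2.1⟩)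

lemma mem_crossingPairs {z : Sym2 V.parts} :
    z ∈ crossingPairs V ↔ ∃ A B : V.parts, (A.1, B.1) ∈ inversions V ∧ z = s(A, B) := by
  simp only [crossingPairs, Finset.mem_image, Finset.mem_attach, true_and, Subtype.exists]
  constructor
  · rintro ⟨⟨A, B⟩, h, rfl⟩
    exact ⟨A, (mem_inversions.mp h).1, B, (mem_inversions.mp h).2.1, h, rfl⟩
  · rintro ⟨A, hA, B, hB, h, rfl⟩
    exact ⟨(A, B), h, rfl⟩

lemma card_crossingPairs : (crossingPairs V).card = (inversions V).card := by
  rw [crossingPairs, Finset.card_image_of_injective, Finset.card_attach]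
  rintro ⟨⟨A, B⟩, h⟩ ⟨⟨A', B'⟩, h'⟩ heq
  simp only [Sym2.eq_iff, Subtype.mk.injEq] at heq
  rcases heq with ⟨rfl, rfl⟩ | ⟨rfl, rfl⟩
  · rfl
  · exact absurd h' (swap_notMem_inversions h)

lemma ne_of_mem_inversions {A B : Finset (Fin k)} (h : (A, B) ∈ inversions V) : A ≠ B := by
  rintro rfl
  exact swap_notMem_inversions h h

lemma not_isDiag_of_mem_crossingPairs {z : Sym2 V.parts} (hz : z ∈ crossingPairs V) :
    ¬ z.IsDiag := by
  obtain ⟨A, B, h, rfl⟩ := mem_crossingPairs.mp hz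
  exact fun hd => ne_of_mem_inversions h (congrArg Subtype.val (Sym2.mk_isDiag_iff.mp hd))

variable {S : Type*} {M : CoxeterMatrix S}

/-- The word obtained from an injective labelling of the blocks of a pair partition represents the
identity if and only if the labels of any two crossing blocks commute. -/
lemma wordProd_ofFn_block_eq_one_iff (hV : V ∈ pairPartitions k) {g : V.parts → S}
    (hg : Function.Injective g) :
    M.wordProd (List.ofFn fun x => g (V.block x)) = 1 ↔
      ∀ z ∈ crossingPairs V, M.pairEntry (z.map g) = 2 := by
  classical
  have hcount : ∀ A, (List.ofFn fun x => g (V.block x)).count (g A) = 2 := by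
    intro A
    rw [count_ofFn_eq_card]
    simp only [hg.eq_iff]
    exact card_filter_block_eq hV A
  constructor
  · intro h z hz
    obtain ⟨A, B, hAB, rfl⟩ := mem_crossingPairs.mp hz
    have hne : g A ≠ g B := hg.ne fun h => ne_of_mem_inversions hAB (congrArg Subtype.val h)
    obtain ⟨-, -, e, f, e', f', hA, hB, h1, h2, h3⟩ := mem_inversions.mp hAB
    refine CoxeterMatrix.eq_two_of_sublist hne (hcount A).le (hcount B).le ?_ h
    rw [alternating_sublist_ofFn_iff]
    have hb : ∀ {x : Fin k} {A : V.parts}, x ∈ A.1 → g (V.block x) = g A := fun hx =>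
      congrArg g (Finpartition.block_eq_iff.mpr hx)
    exact ⟨e, e', f, f', h1, h2, h3, hb (by simp [hA]), hb (by simp [hB]), hb (by simp [hA]),
      hb (by simp [hB])⟩
  · intro h
    refine CoxeterMatrix.wordProd_eq_one_of_sublist _ ?_ ?_
    · intro s hs
      obtain ⟨x, rfl⟩ := (List.mem_ofFn' _ _).mp hs
      exact hcount _
    · intro s t hst hsub
      obtain ⟨x, y, x', y', h1, h2, h3, rfl, rfl, hx, hy⟩ :=
        (alternating_sublist_ofFn_iff _ _ _).mp hsub
      -- Two positions with equal labels exhaust their block, which has two elements.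
      have hpair : ∀ {x x' : Fin k}, x < x' → g (V.block x') = g (V.block x) →
          (V.block x).1 = {x, x'} := by
        intro x x' hlt heq
        refine (Finset.eq_of_subset_of_card_le ?_ ?_).symm
        · intro y hy
          rw [← Finpartition.block_eq_iff]
          rcases Finset.mem_insert.mp hy with rfl | hy
          · rfl
          · rw [Finset.mem_singleton.mp hy]
            exact hg heq
        · rw [mem_pairPartitions.mp hV _ (V.block x).2, Finset.card_pair hlt.ne]
      have := h s(V.block x, V.block y) (mem_crossingPairs.mpr ⟨_, _, mem_inversions.mpr
        ⟨(V.block x).2, (V.block y).2, x, x', y, y', hpair (h1.trans h2) hx,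
          hpair (h2.trans h3) hy, h1, h2, h3⟩, rfl⟩)
      exact this

lemma Finpartition.ext_of_block {V W : Finpartition (Finset.univ : Finset (Fin k))}
    (h : ∀ x y, V.block x = V.block y ↔ W.block x = W.block y) : V = W := by
  have hpart : ∀ x, V.part x = W.part x := by
    intro x
    ext y
    rw [Finpartition.mem_part_iff_block_eq, Finpartition.mem_part_iff_block_eq, h]
  have key : ∀ {V W : Finpartition (Finset.univ : Finset (Fin k))}, (∀ x, V.part x = W.part x) →
      V.parts ⊆ W.parts := by
    intro V W hpart A hA
    obtain ⟨x, hx⟩ := Finpartition.exists_block_eq (⟨A, hA⟩ : V.parts)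
    have : A = W.part x := by rw [← hpart, ← show V.part x = A from congrArg Subtype.val hx]
    rw [this]
    exact W.part_mem.2 (Finset.mem_univ x)
  exact Finpartition.ext ((key hpart).antisymm (key fun x => (hpart x).symm))

open Classical in
/-- Every map all of whose nonempty fibres have two elements is an injective labelling of the
blocks of a pair partition. -/
lemma exists_pairPartition_of_card_fiber {ι : Type*} {I : Fin k → ι}
    (hI : ∀ x, (Finset.univ.filter fun y => I y = I x).card = 2) :
    ∃ V ∈ pairPartitions k, ∃ L : V.parts ↪ ι, ∀ x, L (V.block x) = I x := by
  let V : Finpartition (Finset.univ : Finset (Fin k)) := Finpartition.ofSetoid (Setoid.ker I)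
  have hmem : ∀ x y, y ∈ V.part x ↔ I x = I y := fun x y => Finpartition.mem_part_ofSetoid_iff_rel
  have hblock : ∀ x y, V.block y = V.block x ↔ I y = I x := fun x y => by
    rw [← Finpartition.mem_part_iff_block_eq, hmem, eq_comm]
  choose c hc using fun A : V.parts => Finpartition.exists_block_eq A
  refine ⟨V, mem_pairPartitions.mpr fun A hA => ?_, ⟨fun A => I (c A), fun A B h => ?_⟩, fun x => ?_⟩
  · obtain ⟨x, hx⟩ := Finpartition.exists_block_eq (⟨A, hA⟩ : V.parts)
    rw [← hI x]
    congr 1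
    ext y
    simp only [Finset.mem_filter, Finset.mem_univ, true_and]
    rw [← hblock, hx, Finpartition.block_eq_iff]
  · rw [← hc A, ← hc B, hblock]
    exact h
  · exact (hblock x _).mp (hc _)

-- A map with two-element fibres determines `V` as its kernel, and then `L`, since every block
-- contains a position.
open Classical in
lemma card_filter_card_fiber_eq_two {ι : Type*} [Fintype ι] (Q : (Fin k → ι) → Prop) :
    (Finset.univ.filter fun I : Fin k → ι =>
      Q I ∧ ∀ x, (Finset.univ.filter fun y => I y = I x).card = 2).card =
      ∑ V ∈ pairPartitions k,
        (Finset.univ.filter fun L : V.parts ↪ ι => Q fun x => L (V.block x)).card := by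
  rw [← Finset.card_sigma]
  symm
  refine Finset.card_bij (fun VL _ x => VL.2 (VL.1.block x)) ?_ ?_ ?_
  · rintro ⟨V, L⟩ h
    simp only [Finset.mem_sigma, Finset.mem_filter, Finset.mem_univ, true_and] at h ⊢
    refine ⟨h.2, fun x => ?_⟩
    simp only [L.injective.eq_iff]
    exact card_filter_block_eq h.1 _
  · rintro ⟨V, L⟩ - ⟨W, K⟩ - heq
    have heq' : ∀ x, L (V.block x) = K (W.block x) := congrFun heq
    obtain rfl : V = W := Finpartition.ext_of_block fun x y => by
      rw [← L.injective.eq_iff, heq', heq', K.injective.eq_iff]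
    obtain rfl : L = K := by
      ext1 A
      obtain ⟨x, rfl⟩ := Finpartition.exists_block_eq A
      exact heq' x
    rfl
  · intro I hI
    simp only [Finset.mem_filter, Finset.mem_univ, true_and] at hI
    obtain ⟨V, hV, L, hL⟩ := exists_pairPartition_of_card_fiber hI.2
    have hL' : (fun x => L (V.block x)) = I := funext hL
    exact ⟨⟨V, L⟩, by simpa [hV, hL'] using hI.1, hL'⟩

end PairPartitions

/-! ### Maps with few values -/

section NonPairings

-- A map with at most `q` values factors through `Fin q`.
open Classical in
lemma card_filter_card_image_le {k q : ℕ} (hk : 0 < k) {ι : Type*} [Fintype ι] :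
    (Finset.univ.filter fun I : Fin k → ι => (Finset.univ.image I).card ≤ q).card ≤
      q ^ k * Fintype.card ι ^ q := by
  have hsub : (Finset.univ.filter fun I : Fin k → ι => (Finset.univ.image I).card ≤ q) ⊆
      Finset.univ.image fun (Jh : (Fin k → Fin q) × (Fin q → ι)) x => Jh.2 (Jh.1 x) := by
    intro I hI
    simp only [Finset.mem_filter, Finset.mem_univ, true_and] at hI
    simp only [Finset.mem_image, Finset.mem_univ, true_and]
    obtain ⟨g⟩ : Nonempty ((Finset.univ.image I) ↪ Fin q) :=
        Function.Embedding.nonempty_of_card_le (by rwa [Fintype.card_coe, Fintype.card_fin])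
    let c : Fin k → Finset.univ.image I := fun x => ⟨I x, by simp⟩
    have : Nonempty (Finset.univ.image I) := ⟨c ⟨0, hk⟩⟩
    refine ⟨(fun x => g (c x), fun j => (Function.invFun g j).1), funext fun x => ?_⟩
    change (Function.invFun g (g (c x))).1 = I x
    rw [Function.leftInverse_invFun g.injective]
  refine (Finset.card_le_card hsub).trans (Finset.card_image_le.trans ?_)
  simp

end NonPairings

/-! ### Moments as counts of trivial words -/

section Moments

variable {S : Type*} {M : CoxeterMatrix S}

/-- No fibre is a singleton, so a fibre of size other than `2` has at least `3` elements. -/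
lemma card_image_lt_of_wordProd_eq_one {k : ℕ} {ι : Type*} [DecidableEq ι] {g : ι → S}
    (hg : Function.Injective g) {I : Fin k → ι}
    (hI : M.wordProd (List.ofFn fun x => g (I x)) = 1)
    (hfib : ¬ ∀ x, (Finset.univ.filter fun y => I y = I x).card = 2) :
    2 * (Finset.univ.image I).card < k := by
  classical
  have hge : ∀ x, 2 ≤ (Finset.univ.filter fun y => I y = I x).card := by
    intro x
    have h0 : 0 < (Finset.univ.filter fun y => I y = I x).card :=
      Finset.card_pos.mpr ⟨x, by simp⟩
    have h1 : (Finset.univ.filter fun y => I y = I x).card ≠ 1 := by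
      intro h1
      refine CoxeterMatrix.wordProd_ne_one_of_count_eq_one (s := g (I x)) ?_ hI
      rw [count_ofFn_eq_card]
      simpa only [hg.eq_iff] using h1
    omega
  push Not at hfib
  obtain ⟨x, hx⟩ := hfib
  have hk : k = ∑ b ∈ Finset.univ.image I, (Finset.univ.filter fun y => I y = b).card := by
    rw [← Finset.card_eq_sum_card_image, Finset.card_univ, Fintype.card_fin]
  calc 2 * (Finset.univ.image I).card = ∑ b ∈ Finset.univ.image I, 2 := by simp [mul_comm]
    _ < ∑ b ∈ Finset.univ.image I, (Finset.univ.filter fun y => I y = b).card := by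
        refine Finset.sum_lt_sum ?_ ⟨I x, by simp, lt_of_le_of_ne (hge x) hx.symm⟩
        intro b hb
        obtain ⟨y, -, rfl⟩ := Finset.mem_image.mp hb
        exact hge y
    _ = k := hk.symm

open Classical in
lemma card_nonpairings_mul_sqrt_le (k : ℕ) {g : ℕ → S} (hg : Function.Injective g) (N : ℕ) :
    ((Finset.univ.filter fun I : Fin k → Fin N =>
      M.wordProd (List.ofFn fun x => g (I x)) = 1 ∧
        ¬ ∀ x, (Finset.univ.filter fun y => I y = I x).card = 2).card : ℝ) * √N ≤
      (k : ℝ) ^ k * √N ^ k := by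
  have himg : ∀ I : Fin k → Fin N, M.wordProd (List.ofFn fun x => g (I x)) = 1 ∧
      (¬ ∀ x, (Finset.univ.filter fun y => I y = I x).card = 2) →
      2 * (Finset.univ.image I).card < k := fun I h =>
    card_image_lt_of_wordProd_eq_one (g := fun i : Fin N => g i) (hg.comp Fin.val_injective) h.1 h.2
  rcases Nat.eq_zero_or_pos k with hk | hk
  · rw [Finset.filter_false_of_mem fun I _ h => by have := himg I h; omega]
    simp
    positivity
  rcases Nat.eq_zero_or_pos N with rfl | hN
  · simp
    positivity
  have h1 : (Finset.univ.filter fun I : Fin k → Fin N =>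
      M.wordProd (List.ofFn fun x => g (I x)) = 1 ∧
        ¬ ∀ x, (Finset.univ.filter fun y => I y = I x).card = 2).card ≤
      k ^ k * N ^ ((k - 1) / 2) := by
    refine (Finset.card_le_card (Finset.monotone_filter_right _ fun I _ h => ?_)).trans
      ((card_filter_card_image_le (q := (k - 1) / 2) hk (ι := Fin N)).trans ?_)
    · have h3 : (Finset.univ.image I).card ≤ (k - 1) / 2 := by
        have := himg I h
        omega
      convert h3
    · rw [Fintype.card_fin]
      exact Nat.mul_le_mul_right _ (Nat.pow_le_pow_left (by omega) _)
  have h2 : ((Finset.univ.filter fun I : Fin k → Fin N =>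
      M.wordProd (List.ofFn fun x => g (I x)) = 1 ∧
        ¬ ∀ x, (Finset.univ.filter fun y => I y = I x).card = 2).card : ℝ) ≤
      (k : ℝ) ^ k * (N : ℝ) ^ ((k - 1) / 2) := by exact_mod_cast h1
  have hsq : (√(N : ℝ)) ^ 2 = N := Real.sq_sqrt (Nat.cast_nonneg N)
  have hs1 : 1 ≤ √(N : ℝ) := by
    rw [Real.one_le_sqrt]
    exact_mod_cast hN
  calc _ ≤ (k : ℝ) ^ k * (N : ℝ) ^ ((k - 1) / 2) * √N := by gcongr
    _ = (k : ℝ) ^ k * √N ^ (2 * ((k - 1) / 2) + 1) := by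
        rw [pow_succ, pow_mul, hsq, mul_assoc]
    -- Natural division gives `2 * ((k - 1) / 2) + 1 ≤ k` because `k > 0`.
    _ ≤ (k : ℝ) ^ k * √N ^ k := by
        gcongr
        omega

open Classical in
lemma canonicalTrace_normalizedSum_pow (e : ℕ ≃ S) (N k : ℕ) :
    canonicalTrace M.Group (normalizedSum e M N ^ k) =
      (((Finset.univ.filter fun I : Fin k → Fin N =>
        M.wordProd (List.ofFn fun x => e (I x)) = 1).card / √N ^ k : ℝ) : ℂ) := by
  have hpow : (∑ i ∈ Finset.range N, MonoidAlgebra.of ℂ M.Group (M.simple (e i))) ^ k =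
      ∑ I : Fin k → Fin N, MonoidAlgebra.of ℂ M.Group
        (M.wordProd (List.ofFn fun x => e (I x))) := by
    -- The noncommutative power is expanded as a multilinear map applied to sums.
    rw [Finset.sum_range, ← MultilinearMap.mkPiAlgebraFin_apply_const (R := ℂ),
      MultilinearMap.map_sum]
    refine Finset.sum_congr rfl fun I _ => ?_
    rw [MultilinearMap.mkPiAlgebraFin_apply, CoxeterMatrix.wordProd, map_list_prod,
      List.map_ofFn, List.map_ofFn]
    rfl
  rw [normalizedSum, smul_pow, hpow, canonicalTrace, MonoidAlgebra.coeff_smul_apply,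
    MonoidAlgebra.coeff_sum, Finsupp.finsetSum_apply]
  simp only [MonoidAlgebra.of_apply, MonoidAlgebra.coeff_single, Finsupp.single_apply]
  rw [Finset.sum_boole]
  push_cast
  rw [smul_eq_mul, inv_pow, div_eq_inv_mul]

/-- The moments converge as soon as the densities of the crossing graphs of all pair partitions
converge in the commutation graph of the generators. -/
lemma tendsto_canonicalTrace_normalizedSum_pow (e : ℕ ≃ S) (k : ℕ) (p : ℝ)
    [∀ (N : ℕ) (V : Finpartition (Finset.univ : Finset (Fin k))),
      DecidablePred fun L : V.parts ↪ Fin N => ∀ z ∈ crossingPairs V,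
        M.pairEntry ((z.map fun a => (L a : ℕ)).map e) = 2]
    (h : ∀ V ∈ pairPartitions k, Tendsto (fun N : ℕ =>
      ((Finset.univ.filter fun L : V.parts ↪ Fin N => ∀ z ∈ crossingPairs V,
        M.pairEntry ((z.map fun a => (L a : ℕ)).map e) = 2).card : ℝ)
          / (N : ℝ) ^ Fintype.card V.parts) atTop (𝓝 (p ^ (crossingPairs V).card))) :
    Tendsto (fun N : ℕ => canonicalTrace M.Group (normalizedSum e M N ^ k)) atTop
      (𝓝 ((∑ V ∈ pairPartitions k, p ^ (inversions V).card : ℝ) : ℂ)) := by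
  classical
  simp_rw [canonicalTrace_normalizedSum_pow]
  refine (Complex.continuous_ofReal.tendsto _).comp ?_
  have hsplit : ∀ N : ℕ, ((Finset.univ.filter fun I : Fin k → Fin N =>
        M.wordProd (List.ofFn fun x => e (I x)) = 1).card / √N ^ k : ℝ) =
      (∑ V ∈ pairPartitions k,
        ((Finset.univ.filter fun L : V.parts ↪ Fin N => ∀ z ∈ crossingPairs V,
          M.pairEntry ((z.map fun a => (L a : ℕ)).map e) = 2).card : ℝ)
            / (N : ℝ) ^ Fintype.card V.parts) +
      ((Finset.univ.filter fun I : Fin k → Fin N =>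
        M.wordProd (List.ofFn fun x => e (I x)) = 1 ∧
          ¬ ∀ x, (Finset.univ.filter fun y => I y = I x).card = 2).card : ℝ) / √N ^ k := by
    intro N
    rw [← Finset.card_filter_add_card_filter_not (s := Finset.univ.filter fun I : Fin k → Fin N =>
      M.wordProd (List.ofFn fun x => e (I x)) = 1)
      (fun I => ∀ x, (Finset.univ.filter fun y => I y = I x).card = 2), Finset.filter_filter,
      Finset.filter_filter, Nat.cast_add, add_div]
    congr 1
    have hcard := card_filter_card_fiber_eq_two (k := k) (ι := Fin N)
      fun I => M.wordProd (List.ofFn fun x => e (I x)) = 1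
    have hcard' : (Finset.univ.filter fun I : Fin k → Fin N =>
        M.wordProd (List.ofFn fun x => e (I x)) = 1 ∧
          ∀ x, (Finset.univ.filter fun y => I y = I x).card = 2).card =
        ∑ V ∈ pairPartitions k, (Finset.univ.filter fun L : V.parts ↪ Fin N =>
          M.wordProd (List.ofFn fun x => e (L (V.block x))) = 1).card := by
      convert hcard
    rw [hcard', Nat.cast_sum, Finset.sum_div]
    refine Finset.sum_congr rfl fun V hV => ?_
    -- `V` has `k / 2` blocks, so the moment normalization is that of the graph density.
    have hpow : √(N : ℝ) ^ k = (N : ℝ) ^ Fintype.card V.parts := by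
      rw [Fintype.card_coe, ← Real.sq_sqrt (Nat.cast_nonneg (α := ℝ) N), ← pow_mul,
        two_mul_card_parts hV, Real.sq_sqrt (Nat.cast_nonneg N)]
    rw [hpow]
    congr 3
    ext L
    have hinj : Function.Injective fun A : V.parts => e (L A) :=
      e.injective.comp (Fin.val_injective.comp L.injective)
    simp only [Finset.mem_filter, Finset.mem_univ, true_and]
    rw [wordProd_ofFn_block_eq_one_iff hV hinj]
    simp only [Sym2.map_map]
    rfl
  simp_rw [hsplit]
  rw [← add_zero (∑ V ∈ pairPartitions k, p ^ (inversions V).card)]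
  refine Tendsto.add (tendsto_finsetSum _ fun V hV => ?_) ?_
  · rw [← card_crossingPairs]
    exact h V hV
  · have hlim : Tendsto (fun N : ℕ => (k : ℝ) ^ k / √N) atTop (𝓝 0) :=
      tendsto_const_nhds.div_atTop (Real.tendsto_sqrt_atTop.comp tendsto_natCast_atTop_atTop)
    refine squeeze_zero' (Eventually.of_forall fun N => by positivity) ?_ hlim
    filter_upwards [eventually_gt_atTop 0] with N hN
    have hpos : 0 < √(N : ℝ) := Real.sqrt_pos.mpr (by exact_mod_cast hN)
    rw [div_le_div_iff₀ (by positivity) hpos]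
    convert card_nonpairings_mul_sqrt_le (M := M) k e.injective N

end Moments

/-! ### The random commutation graph and the theorem -/

namespace IsRandomCoxeterMatrix

variable {Ω S : Type*} [MeasurableSpace Ω] {P : Measure Ω} {p : ℝ} {m : Ω → CoxeterMatrix S}

lemma measurable_pairEntry (hm : IsRandomCoxeterMatrix P p m) (z : Sym2 S) :
    Measurable fun ω => (m ω).pairEntry z := by
  induction z using Sym2.ind with
  | _ s t => exact hm.measurable s t

lemma prob_pairEntry_eq_two (hm : IsRandomCoxeterMatrix P p m) {z : Sym2 S} (hz : ¬ z.IsDiag) :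
    P.real ((fun ω => (m ω).pairEntry z) ⁻¹' {2}) = p := by
  induction z using Sym2.ind with
  | _ s t => exact hm.prob_two s t hz

lemma prob_biInter_pairEntry_eq_two (hm : IsRandomCoxeterMatrix P p m) {F : Finset (Sym2 S)}
    (hF : ∀ z ∈ F, ¬ z.IsDiag) :
    P.real (⋂ z ∈ F, (fun ω => (m ω).pairEntry z) ⁻¹' {2}) = p ^ F.card := by
  classical
  have h := hm.indep.measure_inter_preimage_eq_mul (F.subtype fun z => ¬ z.IsDiag)
    (sets := fun _ => {2}) fun _ _ => measurableSet_singleton _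
  have hset : ⋂ z ∈ F, (fun ω => (m ω).pairEntry z) ⁻¹' {2} =
      ⋂ z ∈ F.subtype (fun z : Sym2 S => ¬ z.IsDiag), (fun ω => (m ω).pairEntry z.1) ⁻¹' {2} := by
    ext ω
    simp only [Set.mem_iInter, Finset.mem_subtype, Subtype.forall]
    exact ⟨fun h z _ hz => h z hz, fun h z hz => h z (hF z hz) hz⟩
  rw [hset, measureReal_def, h, ENNReal.toReal_prod]
  calc _ = ∏ z ∈ F.subtype (fun z : Sym2 S => ¬ z.IsDiag), p :=
        Finset.prod_congr rfl fun z _ => hm.prob_pairEntry_eq_two z.2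
    _ = p ^ F.card := by
        rw [Finset.prod_const, Finset.card_subtype, Finset.filter_true_of_mem hF]

end IsRandomCoxeterMatrix

theorem mainTheorem2 {Ω S : Type*} [MeasurableSpace Ω] (P : Measure Ω) [IsProbabilityMeasure P]
    (e : ℕ ≃ S) (p : ℝ) (hp : p ∈ Set.Icc (0 : ℝ) 1)
    (m : Ω → CoxeterMatrix S) (hm : IsRandomCoxeterMatrix P p m) :
    ∀ᵐ ω ∂P, ∀ k : ℕ,
      (Odd k →
        Tendsto (fun N : ℕ => canonicalTrace (m ω).Group (normalizedSum e (m ω) N ^ k))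
          atTop (𝓝 0)) ∧
      (∀ r : ℕ, k = 2 * r →
        Tendsto (fun N : ℕ => canonicalTrace (m ω).Group (normalizedSum e (m ω) N ^ k))
          atTop (𝓝 ((∑ V ∈ pairPartitions k, p ^ (inversions V).card : ℝ) : ℂ))) := by
  classical
  rw [ae_all_iff]
  intro k
  have hdens : ∀ᵐ ω ∂P, ∀ V : Finpartition (Finset.univ : Finset (Fin k)), Tendsto (fun N : ℕ =>
      ((Finset.univ.filter fun L : V.parts ↪ Fin N => ∀ z ∈ crossingPairs V,
        (m ω).pairEntry ((z.map fun a => (L a : ℕ)).map e) = 2).card : ℝ)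
          / (N : ℝ) ^ Fintype.card V.parts) atTop (𝓝 (p ^ (crossingPairs V).card)) := by
    rw [ae_all_iff]
    intro V
    have hdiag : ∀ z : Sym2 ℕ, ¬ z.IsDiag → ¬ (z.map e).IsDiag := fun z hz => by
      rwa [Sym2.isDiag_map e.injective]
    have := ae_tendsto_card_embedding_div (P := P) (crossingPairs V)
      (fun z hz => not_isDiag_of_mem_crossingPairs hz)
      (A := fun z => (fun ω => (m ω).pairEntry (z.map e)) ⁻¹' {2}) (p := p)
      (fun z _ => hm.measurable_pairEntry _ (measurableSet_singleton _)) fun F hF => by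
        rw [← Finset.card_image_of_injective F (Sym2.map.injective e.injective),
          ← hm.prob_biInter_pairEntry_eq_two, Finset.set_biInter_finset_image]
        intro z hz
        obtain ⟨z, hzF, rfl⟩ := Finset.mem_image.mp hz
        exact hdiag z (hF z hzF)
    filter_upwards [this] with ω hω
    convert hω
    rfl
  filter_upwards [hdens] with ω hω
  have hlim := tendsto_canonicalTrace_normalizedSum_pow e k p fun V _ => hω V
  refine ⟨fun hk => ?_, fun r _ => hlim⟩
  -- For odd `k` the limiting sum is empty.
  have hempty : pairPartitions k = ∅ := by
    refine Finset.eq_empty_of_forall_notMem fun V hV => ?_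
    have := two_mul_card_parts hV
    obtain ⟨j, hj⟩ := hk
    omega
  simpa [hempty] using hlim
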